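/- Let $\mathbb{B}=\{z\in\mathbb{C}^n : |z|<1\}$ be the Euclidean unit ball, and let $\mathrm{Aut}(\mathbb{B})$ be the group of holomorphic bijections of $\mathbb{B}$ onto itself. For a real-valued $C^2$ function $\varphi$ near $z$ and $v\in\mathbb{C}^n$, let $$L_z(\varphi,v)=\sum_{k,l=1}^n \frac{\partial^2\varphi}{\partial z_k\,\partial\bar z_l}(z)\,v_k\bar v_l$$ be its Levi form. Let $K(z,\xi)=\sum_\alpha \phi_\alpha(z)\overline{\phi_\alpha(\xi)}$ be the Bergman kernel of $\mathbb{B}$, where $(\phi_\alpha)$ is a complete orthonormal system of the Hilbert space of square-integrable holomorphic functions on $\mathbb{B}$ (with respect to Lebesgue measure), and let $$ds^2(z,v)=\sum_{\mu,\nu=1}^n \frac{\partial^2 \log K(z,z)}{\partial z_\mu\,\partial\bar z_\nu}\,v_\mu\bar v_\nu$$ be the Bergman metric of $\mathbb{B}$. Let $\mathcal{F}$ be a family of holomorphic functions $\mathbb{B}\to\mathbb{C}$ such that: - $\mathcal{F}$ is $\mathrm{Aut}(\mathbb{B})$-invariant: $f\circ g\in\mathcal{F}$ for every $f\in\mathcal{F}$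 and every $g\in\mathrm{Aut}(\mathbb{B})$; - $\mathcal{F}$ is normal in the sense of Montel: every sequence in $\mathcal{F}$ has a subsequence that either converges uniformly on every compact subset of $\mathbb{B}$ to a finite limit function, or converges uniformly to $\infty$ on every compact subset of $\mathbb{B}$. Then there exists a constant $C$ such that $$L_z\bigl(\log(1+|f|^2),v\bigr)\le C\cdot ds^2(z,v)$$ for every $f\in\mathcal{F}$, every $z\in\mathbb{B}$ and every $v\in\mathbb{C}^n$. -/

import Mathlib

open MeasureTheory Filter
open scoped ComplexConjugate

noncomputable section

/-- Complex Euclidean space `ℂⁿ`, with its Euclidean norm and Lebesgue measure. -/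
abbrev CSpace (n : ℕ) : Type := EuclideanSpace ℂ (Fin n)

/-- The open unit ball of `ℂⁿ`. -/
abbrev unitBall (n : ℕ) : Set (CSpace n) := Metric.ball 0 1

/-! ### Wirtinger derivatives and the Levi form -/

/-- `∂φ/∂z_k = (∂φ/∂x_k - i ∂φ/∂y_k) / 2`, where `z_k = x_k + i y_k`. -/
def wirtinger {n : ℕ} (k : Fin n) (φ : CSpace n → ℂ) (z : CSpace n) : ℂ :=
  (fderiv ℝ φ z (EuclideanSpace.single k 1)
    - Complex.I * fderiv ℝ φ z (EuclideanSpace.single k Complex.I)) / 2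

/-- `∂φ/∂z̄_k = (∂φ/∂x_k + i ∂φ/∂y_k) / 2`, where `z_k = x_k + i y_k`. -/
def wirtingerBar {n : ℕ} (k : Fin n) (φ : CSpace n → ℂ) (z : CSpace n) : ℂ :=
  (fderiv ℝ φ z (EuclideanSpace.single k 1)
    + Complex.I * fderiv ℝ φ z (EuclideanSpace.single k Complex.I)) / 2

/-- The Levi form `L_z(φ, v) = ∑_{k,l} ∂²φ/∂z_k∂z̄_l (z) v_k v̄_l` of a real-valued function.
The sum is a real number when `φ` is `C²` near `z`; `re` reads it as an element of `ℝ`. -/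
def leviForm {n : ℕ} (φ : CSpace n → ℝ) (z v : CSpace n) : ℝ :=
  (∑ k, ∑ l, wirtinger k (wirtingerBar l (fun w => (φ w : ℂ))) z * v k * conj (v l)).re

/-! ### The Bergman space, kernel and metric -/

/-- The space of square-integrable holomorphic functions on `Ω`, with the `L²` inner product:
the classes in `L²(Ω)` that have a representative which is holomorphic on `Ω`. -/
def bergmanSpace {n : ℕ} (Ω : Set (CSpace n)) :
    Submodule ℂ (Lp ℂ 2 (volume.restrict Ω)) where
  carrier := {u | ∃ f : CSpace n → ℂ, DifferentiableOn ℂ f Ω ∧ u =ᵐ[volume.restrict Ω] f}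
  add_mem' := by
    rintro u v ⟨f, hf, huf⟩ ⟨g, hg, hvg⟩
    exact ⟨f + g, hf.add hg, (Lp.coeFn_add u v).trans (huf.add hvg)⟩
  zero_mem' := ⟨0, differentiableOn_const 0, Lp.coeFn_zero _ _ _⟩
  smul_mem' := by
    rintro c u ⟨f, hf, huf⟩
    exact ⟨c • f, hf.const_smul c, (Lp.coeFn_smul c u).trans (huf.const_smul c)⟩

/-- The holomorphic representative on `Ω` of an element of the Bergman space
(its values on an open `Ω` are uniquely determined). -/
def bergmanRep {n : ℕ} {Ω : Set (CSpace n)} (u : bergmanSpace Ω) : CSpace n → ℂ :=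
  u.2.choose

/-- A complete (that is, maximal) orthonormal system of the Bergman space exists. -/
theorem exists_complete_orthonormal_system {n : ℕ} (Ω : Set (CSpace n)) :
    ∃ S : Set (bergmanSpace Ω), Orthonormal ℂ ((↑) : S → bergmanSpace Ω) ∧
      ∀ T, S ⊆ T → Orthonormal ℂ ((↑) : T → bergmanSpace Ω) → T = S := by
  obtain ⟨S, -, hS, hmax⟩ :=
    exists_maximal_orthonormal (𝕜 := ℂ) (orthonormal_empty ℂ (bergmanSpace Ω))
  exact ⟨S, hS, fun T hST hT => hmax T hST hT⟩

/-- A complete orthonormal system of the Bergman space of `Ω`. -/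
def bergmanSystem {n : ℕ} (Ω : Set (CSpace n)) : Set (bergmanSpace Ω) :=
  (exists_complete_orthonormal_system Ω).choose

/-- The Bergman kernel `K_Ω(z, ξ) = ∑_α φ_α(z) conj (φ_α(ξ))`, where `(φ_α)` is a complete
orthonormal system of the Bergman space (the sum does not depend on the system). -/
def bergmanKernel {n : ℕ} (Ω : Set (CSpace n)) (z ξ : CSpace n) : ℂ :=
  ∑' u : bergmanSystem Ω, bergmanRep u.1 z * conj (bergmanRep u.1 ξ)

/-- The Bergman metric `ds²(z, v) = ∑_{μ,ν} ∂² log K_Ω(z, z)/∂z_μ∂z̄_ν v_μ v̄_ν`. -/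
def bergmanMetric {n : ℕ} (Ω : Set (CSpace n)) (z v : CSpace n) : ℝ :=
  leviForm (fun w => Real.log (bergmanKernel Ω w w).re) z v

/-! ### Automorphisms, invariant families, normal families

A family of functions on `Ω` is a set of functions `ℂⁿ → ℂ`, of which only the restrictions to
`Ω` matter. -/

/-- `g` restricts to an automorphism of `Ω`: a holomorphic bijection of `Ω` onto itself. -/
def IsAutomorphism {n : ℕ} (Ω : Set (CSpace n)) (g : CSpace n → CSpace n) : Prop :=
  DifferentiableOn ℂ g Ω ∧ Set.BijOn g Ω Ω

/-- The family `F` is `Aut(Ω)`-invariant: for `f ∈ F` and `g ∈ Aut(Ω)`, the function `f ∘ g` on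
`Ω` belongs to the family. -/
def IsAutInvariant {n : ℕ} (Ω : Set (CSpace n)) (F : Set (CSpace n → ℂ)) : Prop :=
  ∀ f ∈ F, ∀ g, IsAutomorphism Ω g → ∃ h ∈ F, Set.EqOn h (f ∘ g) Ω

/-- The family `F` is normal in `Ω` in the sense of Montel: every sequence in `F` has a
subsequence that converges uniformly on every compact subset of `Ω`, either to a finite limit
function or to `∞`. -/
def IsNormalFamily {n : ℕ} (Ω : Set (CSpace n)) (F : Set (CSpace n → ℂ)) : Prop :=
  ∀ f : ℕ → CSpace n → ℂ, (∀ j, f j ∈ F) → ∃ s : ℕ → ℕ, StrictMono s ∧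
    ((∃ f₀ : CSpace n → ℂ, ∀ K ⊆ Ω, IsCompact K →
        TendstoUniformlyOn (fun j => f (s j)) f₀ atTop K) ∨
      ∀ K ⊆ Ω, IsCompact K → ∀ M : ℝ, ∀ᶠ j in atTop, ∀ z ∈ K, M < ‖f (s j) z‖)

end

/-! The Levi form of `log (1 + |f|²)` is `|df(v)|² / (1 + |f|²)²`, the pull-back of the spherical
metric, so the claim compares the spherical derivative of `f` with the Bergman metric. Both sides
transform well under automorphisms, and it suffices to have a uniform bound at the centre.

The bound at the centre is one half of Marty's criterion. If `‖df(0)‖ ≤ C (1 + |f(0)|²)` failed for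
every `C`, a sequence of counterexamples would have a subsequence that is eventually uniformly
bounded on the ball of radius 1/2, or eventually larger than 1 in modulus there. Cauchy's estimate
for `f`, respectively for `1/f`, contradicts either case.

To reach a point `a`, let `φ` be the involution exchanging `0` and `a`. Some `h` in the family
equals `f ∘ φ` on the ball, and `df(a) v = dh(0) (φ'(a) v)` because `φ'(0) φ'(a) = id`. Finally
`ds²(a, v) = (n + 1) ‖φ'(a) v‖²`, which yields the constant `C² / (n + 1)`.

The last identity needs `K(a, a) = (1 - |a|²)^(-(n+1)) / vol`. By Parseval, `K(a, a)` is the squared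
norm of evaluation at `a`. The mean value inequality at `0`, transported by `φ`, bounds this norm
from above (`enorm_sq_mul_volume_le`), and the Jacobian of `φ` attains the bound
(`norm_sq_bergmanEval`). -/

noncomputable section

open Metric
open scoped InnerProductSpace Topology ENNReal

/-! ### The involutive automorphisms of the ball -/

/-- The number `√(1 - |a|²)`. -/
def ballDefect {n : ℕ} (a : CSpace n) : ℝ := √(1 - ‖a‖ ^ 2)

/-- The involution of the unit ball that exchanges `0` and `a`. -/
def ballInvolution {n : ℕ} (a z : CSpace n) : CSpace n :=
  (1 - ⟪a, z⟫_ℂ)⁻¹ • (a - (ballDefect a : ℂ) • z - (⟪a, z⟫_ℂ / (1 + ballDefect a)) • a)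

section

variable {n : ℕ} {a z : CSpace n}

theorem norm_sq_lt_one_of_mem_unitBall (ha : a ∈ unitBall n) : ‖a‖ ^ 2 < 1 := by
  have h : ‖a‖ < 1 := by simpa using ha
  have h0 := norm_nonneg a
  nlinarith

theorem ballDefect_pos (ha : a ∈ unitBall n) : 0 < ballDefect a :=
  Real.sqrt_pos.2 (by linarith [norm_sq_lt_one_of_mem_unitBall ha])

theorem ballDefect_sq (ha : a ∈ unitBall n) : ballDefect a ^ 2 = 1 - ‖a‖ ^ 2 :=
  Real.sq_sqrt (by linarith [norm_sq_lt_one_of_mem_unitBall ha])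

theorem inner_self_eq_one_sub_ballDefect_sq (ha : a ∈ unitBall n) :
    ⟪a, a⟫_ℂ = 1 - (ballDefect a : ℂ) ^ 2 := by
  rw [inner_self_eq_norm_sq_to_K]
  have h2 : ‖a‖ ^ 2 = 1 - ballDefect a ^ 2 := by linarith [ballDefect_sq ha]
  simpa using congrArg (fun x : ℝ => (x : ℂ)) h2

theorem inner_self_eq_ofReal_norm_sq (z : CSpace n) : ⟪z, z⟫_ℂ = ((‖z‖ ^ 2 : ℝ) : ℂ) := by
  rw [inner_self_eq_norm_sq_to_K]
  simp

theorem ofReal_ballDefect_ne_zero (ha : a ∈ unitBall n) : (ballDefect a : ℂ) ≠ 0 := by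
  exact_mod_cast (ballDefect_pos ha).ne'

theorem one_add_ofReal_ballDefect_ne_zero (ha : a ∈ unitBall n) :
    (1 + ballDefect a : ℂ) ≠ 0 := by
  have := ballDefect_pos ha
  exact_mod_cast (by positivity : (1 + ballDefect a : ℝ) ≠ 0)

theorem one_sub_inner_ne_zero (ha : a ∈ unitBall n) (hz : z ∈ unitBall n) :
    1 - ⟪a, z⟫_ℂ ≠ 0 := by
  intro h
  have h1 : ⟪a, z⟫_ℂ = 1 := by linear_combination -h
  have h2 := norm_inner_le_norm (𝕜 := ℂ) a z
  have h3 : ‖a‖ < 1 := by simpa using ha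
  have h4 : ‖z‖ < 1 := by simpa using hz
  rw [h1, norm_one] at h2
  nlinarith [norm_nonneg a, norm_nonneg z]

theorem inner_ballInvolution (ha : a ∈ unitBall n) :
    ⟪a, ballInvolution a z⟫_ℂ =
      (1 - ⟪a, z⟫_ℂ)⁻¹ * (1 - (ballDefect a : ℂ) ^ 2 - ⟪a, z⟫_ℂ) := by
  have hs := one_add_ofReal_ballDefect_ne_zero ha
  simp only [ballInvolution, inner_smul_right, inner_sub_right,
    inner_self_eq_one_sub_ballDefect_sq ha]
  congr 1
  field_simp
  ring

theorem one_sub_inner_ballInvolution (ha : a ∈ unitBall n) (hz : z ∈ unitBall n) :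
    1 - ⟪a, ballInvolution a z⟫_ℂ = (ballDefect a : ℂ) ^ 2 / (1 - ⟪a, z⟫_ℂ) := by
  have hD := one_sub_inner_ne_zero ha hz
  rw [inner_ballInvolution ha]
  field_simp
  ring

theorem ballInvolution_ballInvolution (ha : a ∈ unitBall n) (hz : z ∈ unitBall n) :
    ballInvolution a (ballInvolution a z) = z := by
  have hD := one_sub_inner_ne_zero ha hz
  have hs := one_add_ofReal_ballDefect_ne_zero ha
  have hs0 := ofReal_ballDefect_ne_zero ha
  have h1 := one_sub_inner_ballInvolution ha hz
  have h2 := inner_ballInvolution (z := z) ha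
  rw [ballInvolution, h1, h2]
  simp only [ballInvolution]
  match_scalars
  · field_simp
    ring
  · field_simp

/-- This identity is why the ball is mapped into itself: the right side is positive for `z` in the
ball. Expanding the inner products reduces it to a rational identity in `⟪a, z⟫`, its conjugate,
`⟪z, z⟫` and the defect. -/
theorem one_sub_norm_sq_ballInvolution (ha : a ∈ unitBall n) (hz : z ∈ unitBall n) :
    1 - ‖ballInvolution a z‖ ^ 2 =
      ballDefect a ^ 2 * (1 - ‖z‖ ^ 2) / ‖1 - ⟪a, z⟫_ℂ‖ ^ 2 := by
  have hD := one_sub_inner_ne_zero ha hz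
  have hD' : 1 - ⟪z, a⟫_ℂ ≠ 0 := one_sub_inner_ne_zero hz ha
  have hs := one_add_ofReal_ballDefect_ne_zero ha
  have hconj : conj ⟪a, z⟫_ℂ = ⟪z, a⟫_ℂ := inner_conj_symm _ _
  have key : (1 : ℂ) - ⟪ballInvolution a z, ballInvolution a z⟫_ℂ =
      ballDefect a ^ 2 * (1 - ⟪z, z⟫_ℂ) / (conj (1 - ⟪a, z⟫_ℂ) * (1 - ⟪a, z⟫_ℂ)) := by
    simp only [ballInvolution, inner_smul_right, inner_sub_right, inner_smul_left, inner_sub_left,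
      inner_self_eq_one_sub_ballDefect_sq ha, map_inv₀, map_sub, map_one, map_div₀, map_add,
      Complex.conj_ofReal, hconj]
    field_simp
    ring
  rw [Complex.conj_mul', inner_self_eq_ofReal_norm_sq, inner_self_eq_ofReal_norm_sq] at key
  exact_mod_cast key

theorem ballInvolution_mem (ha : a ∈ unitBall n) (hz : z ∈ unitBall n) :
    ballInvolution a z ∈ unitBall n := by
  have h := one_sub_norm_sq_ballInvolution ha hz
  have hD := norm_pos_iff.2 (one_sub_inner_ne_zero ha hz)
  have hs := ballDefect_pos ha
  have hz1 : 0 < 1 - ‖z‖ ^ 2 := by linarith [norm_sq_lt_one_of_mem_unitBall hz]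
  have h1 : 0 < 1 - ‖ballInvolution a z‖ ^ 2 := by rw [h]; positivity
  have h2 : ‖ballInvolution a z‖ < 1 := by
    by_contra! hc
    nlinarith
  simpa using h2

theorem zero_mem_unitBall : (0 : CSpace n) ∈ unitBall n := by simp

@[simp] theorem ballInvolution_zero : ballInvolution a 0 = a := by
  simp [ballInvolution]

theorem ballInvolution_self (ha : a ∈ unitBall n) : ballInvolution a a = 0 := by
  simpa using ballInvolution_ballInvolution ha (zero_mem_unitBall (n := n))

theorem bijOn_ballInvolution (ha : a ∈ unitBall n) :
    Set.BijOn (ballInvolution a) (unitBall n) (unitBall n) :=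
  Set.InvOn.bijOn
    ⟨fun _ hz => ballInvolution_ballInvolution ha hz,
      fun _ hz => ballInvolution_ballInvolution ha hz⟩
    (fun _ hz => ballInvolution_mem ha hz) (fun _ hz => ballInvolution_mem ha hz)

/-- The derivative of `ballInvolution a` at `z`. -/
def ballInvolutionDeriv (a z : CSpace n) : CSpace n →L[ℂ] CSpace n :=
  (-(ballDefect a : ℂ) / (1 - ⟪a, z⟫_ℂ)) •
    (ContinuousLinearMap.id ℂ (CSpace n) + (innerSL ℂ a).smulRight
      ((ballDefect a : ℂ)⁻¹ • ((1 + ballDefect a : ℂ)⁻¹ • a - ballInvolution a z)))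

theorem hasFDerivAt_ballInvolution (ha : a ∈ unitBall n) (hz : z ∈ unitBall n) :
    HasFDerivAt (ballInvolution a) (ballInvolutionDeriv a z) z := by
  have hD := one_sub_inner_ne_zero ha hz
  have hs := one_add_ofReal_ballDefect_ne_zero ha
  have hs0 := ofReal_ballDefect_ne_zero ha
  have h1 : HasFDerivAt (fun w : CSpace n => ⟪a, w⟫_ℂ) (innerSL ℂ a) z :=
    (innerSL ℂ a).hasFDerivAt
  have h2 := (hasDerivAt_inv hD).comp_hasFDerivAt z (h1.const_sub 1)
  have h3 := (((hasFDerivAt_id (𝕜 := ℂ) z).const_smul (ballDefect a : ℂ)).const_sub a).sub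
    ((h1.mul_const (1 + ballDefect a : ℂ)⁻¹).smul_const a)
  refine (h2.smul h3).congr_fderiv ?_ |>.congr_of_eventuallyEq (.of_forall fun w => ?_)
  · ext1 u
    change (1 - ⟪a, z⟫_ℂ)⁻¹ • (-((ballDefect a : ℂ) • u) -
        ((1 + ballDefect a : ℂ)⁻¹ * ⟪a, u⟫_ℂ) • a) +
      (-((1 - ⟪a, z⟫_ℂ) ^ 2)⁻¹ * -⟪a, u⟫_ℂ) •
        (a - (ballDefect a : ℂ) • z - (⟪a, z⟫_ℂ * (1 + ballDefect a : ℂ)⁻¹) • a) =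
      (-(ballDefect a : ℂ) / (1 - ⟪a, z⟫_ℂ)) • (u + ⟪a, u⟫_ℂ • ((ballDefect a : ℂ)⁻¹ •
        ((1 + ballDefect a : ℂ)⁻¹ • a - (1 - ⟪a, z⟫_ℂ)⁻¹ •
          (a - (ballDefect a : ℂ) • z - (⟪a, z⟫_ℂ / (1 + ballDefect a)) • a))))
    match_scalars
    · field_simp
    · field_simp
      ring
    · field_simp
  · simp [ballInvolution, div_eq_mul_inv]

theorem isAutomorphism_ballInvolution (ha : a ∈ unitBall n) :
    IsAutomorphism (unitBall n) (ballInvolution a) :=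
  ⟨fun _ hz => (hasFDerivAt_ballInvolution ha hz).differentiableAt.differentiableWithinAt,
    bijOn_ballInvolution ha⟩

/-- The Jacobian determinant of `ballInvolution a` at `z`. -/
def ballInvolutionJacobian (a z : CSpace n) : ℂ :=
  (-1) ^ n * ((ballDefect a : ℂ) / (1 - ⟪a, z⟫_ℂ)) ^ (n + 1)

/-- The derivative is a scalar times a transvection `u ↦ u + ⟪a, u⟫ w`. The scalar contributes `n`
factors and the transvection, of determinant `1 + ⟪a, w⟫`, one more: hence the exponent `n + 1`. -/
theorem det_ballInvolutionDeriv (ha : a ∈ unitBall n) (hz : z ∈ unitBall n) :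
    LinearMap.det (ballInvolutionDeriv a z : CSpace n →ₗ[ℂ] CSpace n) =
      ballInvolutionJacobian a z := by
  have hD := one_sub_inner_ne_zero ha hz
  have hs := one_add_ofReal_ballDefect_ne_zero ha
  have hs0 := ofReal_ballDefect_ne_zero ha
  set w : CSpace n :=
    (ballDefect a : ℂ)⁻¹ • ((1 + ballDefect a : ℂ)⁻¹ • a - ballInvolution a z) with hw
  have h : (ballInvolutionDeriv a z : CSpace n →ₗ[ℂ] CSpace n) =
      (-(ballDefect a : ℂ) / (1 - ⟪a, z⟫_ℂ)) •
        LinearMap.transvection (innerSL ℂ a : CSpace n →ₗ[ℂ] ℂ) w := by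
    ext1 u
    simp [ballInvolutionDeriv, LinearMap.transvection.apply, hw]
  rw [h, LinearMap.det_smul, LinearMap.transvection.det]
  have h2 : 1 + (innerSL ℂ a : CSpace n →ₗ[ℂ] ℂ) w = ballDefect a / (1 - ⟪a, z⟫_ℂ) := by
    simp only [hw, ContinuousLinearMap.coe_coe, innerSL_apply_apply, inner_smul_right,
      inner_sub_right, inner_ballInvolution ha, inner_self_eq_one_sub_ballDefect_sq ha]
    field_simp
    ring
  rw [h2, finrank_euclideanSpace_fin, ballInvolutionJacobian, neg_div, neg_pow, pow_succ]
  ring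

theorem differentiableOn_ballInvolutionJacobian (ha : a ∈ unitBall n) :
    DifferentiableOn ℂ (ballInvolutionJacobian a) (unitBall n) := by
  intro z hz
  have hD := one_sub_inner_ne_zero ha hz
  have h1 : DifferentiableAt ℂ (fun w : CSpace n => ⟪a, w⟫_ℂ) z :=
    (innerSL ℂ a).differentiableAt
  have h2 : DifferentiableAt ℂ (fun w => (ballDefect a : ℂ) / (1 - ⟪a, w⟫_ℂ)) z :=
    ((h1.const_sub 1).fun_inv hD).const_mul _
  exact ((h2.fun_pow _).const_mul _).differentiableWithinAt

theorem norm_sq_ballInvolutionJacobian_zero (ha : a ∈ unitBall n) :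
    ‖ballInvolutionJacobian a 0‖ ^ 2 = (1 - ‖a‖ ^ 2) ^ (n + 1) := by
  rw [← ballDefect_sq ha]
  simp [ballInvolutionJacobian, abs_of_pos (ballDefect_pos ha), ← pow_mul, mul_comm]

theorem norm_sq_ballInvolutionJacobian_self (ha : a ∈ unitBall n) :
    ‖ballInvolutionJacobian a a‖ ^ 2 = ((1 - ‖a‖ ^ 2) ^ (n + 1))⁻¹ := by
  have hs0 := ofReal_ballDefect_ne_zero ha
  have : (ballDefect a : ℂ) / (1 - ⟪a, a⟫_ℂ) = (ballDefect a : ℂ)⁻¹ := by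
    rw [inner_self_eq_one_sub_ballDefect_sq ha]
    field_simp
    ring
  rw [ballInvolutionJacobian, this, ← ballDefect_sq ha]
  simp [abs_of_pos (ballDefect_pos ha), ← pow_mul, mul_comm]

/-- The right side is the Bergman metric at `a` up to the factor `n + 1`. -/
theorem norm_sq_ballInvolutionDeriv_self (ha : a ∈ unitBall n) (v : CSpace n) :
    ‖ballInvolutionDeriv a a v‖ ^ 2 =
      ‖v‖ ^ 2 / (1 - ‖a‖ ^ 2) + ‖⟪a, v⟫_ℂ‖ ^ 2 / (1 - ‖a‖ ^ 2) ^ 2 := by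
  have hs := one_add_ofReal_ballDefect_ne_zero ha
  have hs0 := ofReal_ballDefect_ne_zero ha
  have hconj : conj ⟪a, v⟫_ℂ = ⟪v, a⟫_ℂ := inner_conj_symm _ _
  have hD : 1 - ⟪a, a⟫_ℂ = (ballDefect a : ℂ) ^ 2 := by
    rw [inner_self_eq_one_sub_ballDefect_sq ha]
    ring
  have key : ⟪ballInvolutionDeriv a a v, ballInvolutionDeriv a a v⟫_ℂ =
      ⟪v, v⟫_ℂ / (ballDefect a : ℂ) ^ 2 +
        (conj ⟪a, v⟫_ℂ * ⟪a, v⟫_ℂ) / ((ballDefect a : ℂ) ^ 2) ^ 2 := by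
    have h1 : ballInvolutionDeriv a a v = (-(ballDefect a : ℂ) / (ballDefect a : ℂ) ^ 2) •
        (v + (⟪a, v⟫_ℂ * ((ballDefect a : ℂ)⁻¹ * (1 + ballDefect a : ℂ)⁻¹)) • a) := by
      rw [← hD]
      simp [ballInvolutionDeriv, ballInvolution_self ha, smul_smul]
    simp only [h1, inner_smul_right, inner_add_right, inner_smul_left, inner_add_left, map_inv₀,
      map_div₀, map_add, map_neg, map_pow, map_mul, map_one, Complex.conj_ofReal, hconj,
      inner_self_eq_one_sub_ballDefect_sq ha]
    field_simp
    ring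
  rw [Complex.conj_mul', inner_self_eq_ofReal_norm_sq, inner_self_eq_ofReal_norm_sq] at key
  rw [← ballDefect_sq ha]
  exact_mod_cast key

/-- Chain rule at `a` for an involution that sends `a` to `0`. -/
theorem ballInvolutionDeriv_zero_comp_self (ha : a ∈ unitBall n) (v : CSpace n) :
    ballInvolutionDeriv a 0 (ballInvolutionDeriv a a v) = v := by
  have h1 : HasFDerivAt (ballInvolution a) (ballInvolutionDeriv a 0) (ballInvolution a a) := by
    rw [ballInvolution_self ha]
    exact hasFDerivAt_ballInvolution ha zero_mem_unitBall
  have h2 := h1.comp a (hasFDerivAt_ballInvolution ha ha)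
  have h3 : ballInvolution a ∘ ballInvolution a =ᶠ[nhds a] id :=
    Filter.mem_of_superset (isOpen_ball.mem_nhds ha)
      fun z hz => ballInvolution_ballInvolution ha hz
  have h4 := h2.unique (h3.symm.hasFDerivAt_iff.1 (hasFDerivAt_id a))
  simpa using congrArg (fun L => L v) h4

end

/-! ### Holomorphic functions of several variables -/

section

variable {E : Type*} [NormedAddCommGroup E] [NormedSpace ℂ E]

/-- Cauchy's estimate for the Fréchet derivative. -/
theorem norm_fderiv_le_of_norm_le_on_ball {f : E → ℂ} {c : E} {R M : ℝ} (hR : 0 < R)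
    (hf : DifferentiableOn ℂ f (ball c R)) (hM : ∀ z ∈ ball c R, ‖f z‖ ≤ M) :
    ‖fderiv ℂ f c‖ ≤ 2 * M / R := by
  refine Complex.norm_fderiv_le_div_of_mapsTo_ball hf (fun z hz => ?_) hR
  have h1 := hM z hz
  have h2 := hM c (mem_ball_self hR)
  rw [mem_closedBall, dist_eq_norm]
  linarith [norm_sub_le (f z) (f c)]

/-- Cauchy's formula for `ζ ↦ f (z + ζ v)`, holomorphic on the disc of radius 2 since `2 ‖v‖ < r`.
It turns the derivative into an integral that can be differentiated in `z`. -/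
theorem fderiv_apply_eq_circleIntegral {f : E → ℂ} {z v : E} {r : ℝ}
    (hf : DifferentiableOn ℂ f (ball z r)) (hv : 2 * ‖v‖ < r) :
    fderiv ℂ f z v =
      (2 * Real.pi * Complex.I : ℂ)⁻¹ • ∮ ζ in C(0, 1), ((ζ - 0) ^ 2)⁻¹ • f (z + ζ • v) := by
  have hr : 0 < r := by linarith [norm_nonneg v]
  have hmaps : Set.MapsTo (fun ζ : ℂ => z + ζ • v) (ball 0 2) (ball z r) := by
    intro ζ hζ
    rw [mem_ball_zero_iff] at hζ
    rw [mem_ball_iff_norm, add_sub_cancel_left, norm_smul]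
    nlinarith [norm_nonneg v]
  have hd : DifferentiableOn ℂ (fun ζ : ℂ => f (z + ζ • v)) (ball 0 2) :=
    hf.comp (f := fun ζ : ℂ => z + ζ • v) (by fun_prop) hmaps
  have hderiv : HasDerivAt (fun ζ : ℂ => f (z + ζ • v)) (fderiv ℂ f z v) 0 := by
    have h1 : HasDerivAt (fun ζ : ℂ => z + ζ • v) v 0 := by
      simpa using ((hasDerivAt_id (0 : ℂ)).smul_const v).const_add z
    have h2 : HasFDerivAt f (fderiv ℂ f z) (z + (0 : ℂ) • v) := by
      simpa using (hf.differentiableAt (ball_mem_nhds z hr)).hasFDerivAt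
    exact h2.comp_hasDerivAt 0 h1
  rw [← hderiv.deriv]
  exact (Complex.two_pi_I_inv_smul_circleIntegral_sub_sq_inv_smul_of_differentiable isOpen_ball
    (closedBall_subset_ball (by norm_num)) hd (mem_ball_self one_pos)).symm

/-- The directional derivatives of a holomorphic function are holomorphic. -/
theorem differentiableAt_fderiv_apply [FiniteDimensional ℂ E] {f : E → ℂ} {U : Set E}
    (hU : IsOpen U) (hf : DifferentiableOn ℂ f U) {z : E} (hz : z ∈ U) (v : E) :
    DifferentiableAt ℂ (fun w => fderiv ℂ f w v) z := by
  obtain ⟨r, M, hr, hrU, hM⟩ : ∃ r M : ℝ, 0 < r ∧ ball z (4 * r) ⊆ U ∧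
      ∀ w ∈ ball z (4 * r), ‖f w‖ ≤ M := by
    have hc := (hf.continuousOn.continuousAt (hU.mem_nhds hz)).norm
    have h1 : ∀ᶠ w in 𝓝 z, ‖f w‖ < ‖f z‖ + 1 := hc.eventually (gt_mem_nhds (by linarith))
    obtain ⟨ε, hε, h⟩ := Metric.eventually_nhds_iff_ball.1 (h1.and (hU.mem_nhds hz))
    exact ⟨ε / 4, ‖f z‖ + 1, by positivity,
      fun w hw => (h w (by rwa [mul_div_cancel₀ _ (by norm_num)] at hw)).2,
      fun w hw => (h w (by rwa [mul_div_cancel₀ _ (by norm_num)] at hw)).1.le⟩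
  have hf' := hf.mono hrU
  -- By linearity in `v`, short vectors suffice.
  suffices H : ∀ v : E, 2 * ‖v‖ < r → DifferentiableAt ℂ (fun w => fderiv ℂ f w v) z by
    obtain ⟨t, ht0, ht⟩ : ∃ t : ℝ, 0 < t ∧ 2 * (t * ‖v‖) < r := by
      refine ⟨r / (2 * (‖v‖ + 1)), by positivity, ?_⟩
      have := norm_nonneg v
      rw [div_mul_eq_mul_div, ← mul_div_assoc, div_lt_iff₀ (by positivity)]
      nlinarith
    have h1 := (H ((t : ℂ) • v) (by rwa [norm_smul, Complex.norm_of_nonneg ht0.le])).const_mul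
      (t : ℂ)⁻¹
    refine h1.congr_of_eventuallyEq (.of_forall fun w => ?_)
    simp [ht0.ne']
  intro v hv
  have hball : ∀ w ∈ ball z r, ∀ θ : ℝ, w + circleMap 0 1 θ • v ∈ ball z (2 * r) := by
    intro w hw θ
    rw [mem_ball_iff_norm] at hw ⊢
    calc ‖w + circleMap 0 1 θ • v - z‖ = ‖(w - z) + circleMap 0 1 θ • v‖ := by congr 1; abel
      _ ≤ ‖w - z‖ + ‖circleMap 0 1 θ • v‖ := norm_add_le _ _
      _ < 2 * r := by
        rw [norm_smul, norm_circleMap_zero, abs_one, one_mul]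
        linarith [norm_nonneg v]
  set c : ℝ → ℂ := fun θ => deriv (circleMap 0 1) θ * ((circleMap 0 1 θ - 0) ^ 2)⁻¹ with hc
  have hc1 : ∀ θ, ‖c θ‖ = 1 := fun θ => by simp [hc]
  have hcc : Continuous c := by
    have h0 : ∀ θ, (circleMap 0 1 θ - 0) ^ 2 ≠ 0 := fun θ => by simp
    simp only [hc, deriv_circleMap]
    exact ((continuous_circleMap 0 1).mul continuous_const).mul
      ((((continuous_circleMap 0 1).sub continuous_const).pow 2).inv₀ h0)
  have hcont : ∀ w ∈ ball z r, Continuous fun θ : ℝ => c θ * f (w + circleMap 0 1 θ • v) := by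
    intro w hw
    refine hcc.mul (hf'.continuousOn.comp_continuous
      (continuous_const.add ((continuous_circleMap 0 1).smul continuous_const)) fun θ => ?_)
    exact ball_subset_ball (by linarith) (hball w hw θ)
  borelize E
  -- Continuity of the derivative is not yet available, so measurability comes from
  -- `measurable_fderiv`.
  have hmeas : AEStronglyMeasurable
      (fun θ : ℝ => c θ • fderiv ℂ f (z + circleMap 0 1 θ • v))
      (volume.restrict (Set.uIoc 0 (2 * Real.pi))) := by
    have : ProperSpace E := FiniteDimensional.proper ℂ E
    have : FiniteDimensional ℂ (E →L[ℂ] ℂ) := inferInstance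
    have : ProperSpace (E →L[ℂ] ℂ) := FiniteDimensional.proper ℂ _
    refine (hcc.aestronglyMeasurable).smul (Measurable.aestronglyMeasurable ?_)
    exact (measurable_fderiv ℂ f).comp
      (continuous_const.add ((continuous_circleMap 0 1).smul continuous_const)).measurable
  have key := intervalIntegral.hasFDerivAt_integral_of_dominated_of_fderiv_le (𝕜 := ℂ)
    (μ := volume) (a := 0) (b := 2 * Real.pi)
    (F := fun w θ => c θ * f (w + circleMap 0 1 θ • v))
    (F' := fun w θ => c θ • fderiv ℂ f (w + circleMap 0 1 θ • v))
    (bound := fun _ => 2 * M / r) (ball_mem_nhds z hr)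
    (Filter.mem_of_superset (ball_mem_nhds z hr) fun w hw => (hcont w hw).aestronglyMeasurable)
    ((hcont z (mem_ball_self hr)).intervalIntegrable _ _) hmeas
    (.of_forall fun θ _ w hw => ?_) intervalIntegrable_const (.of_forall fun θ _ w hw => ?_)
  · refine (key.differentiableAt.const_mul (2 * Real.pi * Complex.I : ℂ)⁻¹).congr_of_eventuallyEq ?_
    filter_upwards [ball_mem_nhds z hr] with w hw
    rw [fderiv_apply_eq_circleIntegral (r := r) (hf'.mono ?_) hv, circleIntegral]
    · simp only [hc, smul_eq_mul, mul_assoc]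
    · refine ball_subset_ball' ?_
      rw [mem_ball] at hw
      linarith
  · rw [norm_smul, hc1, one_mul]
    have hsub : ball (w + circleMap 0 1 θ • v) r ⊆ ball z (4 * r) := by
      refine ball_subset_ball' ?_
      have := hball w hw θ
      rw [mem_ball] at this
      linarith
    exact norm_fderiv_le_of_norm_le_on_ball hr (hf'.mono hsub) fun y hy => hM y (hsub hy)
  · have h1 : HasFDerivAt f (fderiv ℂ f (w + circleMap 0 1 θ • v)) (w + circleMap 0 1 θ • v) :=
      (hf'.differentiableAt (isOpen_ball.mem_nhds
        (ball_subset_ball (by linarith) (hball w hw θ)))).hasFDerivAt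
    have h2 : HasFDerivAt (fun w : E => w + circleMap 0 1 θ • v) (ContinuousLinearMap.id ℂ E) w :=
      (hasFDerivAt_id w).add_const _
    exact (h1.comp w h2).const_mul _

/-- A uniform limit of holomorphic functions is holomorphic. -/
theorem differentiableAt_of_tendstoUniformlyOn_ball {f : ℕ → E → ℂ} {g : E → ℂ} {x : E} {R : ℝ}
    (hR : 0 < R) (hf : ∀ k, DifferentiableOn ℂ (f k) (ball x R))
    (hfg : TendstoUniformlyOn f g atTop (ball x R)) : DifferentiableAt ℂ g x := by
  have hd : ∀ k, ∀ y ∈ ball x R, DifferentiableAt ℂ (f k) y := fun k y hy =>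
    (hf k).differentiableAt (isOpen_ball.mem_nhds hy)
  have hR2 : 0 < R / 2 := by positivity
  have hsub : ∀ y ∈ ball x (R / 2), ball y (R / 2) ⊆ ball x R := by
    intro y hy
    refine ball_subset_ball' ?_
    rw [mem_ball] at hy
    linarith
  have hc : UniformCauchySeqOn (fun k => fderiv ℂ (f k)) atTop (ball x (R / 2)) := by
    rw [Metric.uniformCauchySeqOn_iff]
    intro ε hε
    -- Cauchy's estimate on balls of radius `R / 2` turns `ε R / 8` into `ε / 2`.
    obtain ⟨N, hN⟩ := Metric.uniformCauchySeqOn_iff.1 hfg.uniformCauchySeqOn (ε * R / 8)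
      (by positivity)
    refine ⟨N, fun k hk l hl y hy => ?_⟩
    have hyR : y ∈ ball x R := hsub y hy (mem_ball_self hR2)
    rw [dist_eq_norm, ← fderiv_sub (hd k y hyR) (hd l y hyR)]
    refine (norm_fderiv_le_of_norm_le_on_ball (M := ε * R / 8) hR2
      (((hf k).sub (hf l)).mono (hsub y hy)) fun w hw => ?_).trans_lt ?_
    · rw [Pi.sub_apply, ← dist_eq_norm]
      exact (hN k hk l hl w (hsub y hy hw)).le
    · field_simp
      norm_num
  have hlim : ∀ y ∈ ball x (R / 2), ∃ L, Tendsto (fun k => fderiv ℂ (f k) y) atTop (𝓝 L) :=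
    fun y hy => cauchySeq_tendsto_of_complete (hc.cauchySeq hy)
  choose! g' hg' using hlim
  exact (hasFDerivAt_of_tendstoUniformlyOn isOpen_ball (hc.tendstoUniformlyOn_of_tendsto hg')
    (fun k y hy => (hd k y (hsub y hy (mem_ball_self hR2))).hasFDerivAt)
    (fun y hy => hfg.tendsto_at (hsub y hy (mem_ball_self hR2)))
    (mem_ball_self hR2)).differentiableAt

end

/-! ### Levi forms -/

section

variable {n : ℕ}

/-- The second direction is written as `I •` the first so that `map_smul` applies where `L` is built
from complex-linear maps. -/
theorem wirtinger_eq {φ : CSpace n → ℂ} {z : CSpace n} {L : CSpace n →L[ℝ] ℂ}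
    (h : HasFDerivAt φ L z) (k : Fin n) :
    wirtinger k φ z = (L (EuclideanSpace.single k 1)
      - Complex.I * L (Complex.I • EuclideanSpace.single k (1 : ℂ))) / 2 := by
  rw [wirtinger, h.fderiv]
  congr 4
  ext i
  simp

theorem wirtingerBar_eq {φ : CSpace n → ℂ} {z : CSpace n} {L : CSpace n →L[ℝ] ℂ}
    (h : HasFDerivAt φ L z) (k : Fin n) :
    wirtingerBar k φ z = (L (EuclideanSpace.single k 1)
      + Complex.I * L (Complex.I • EuclideanSpace.single k (1 : ℂ))) / 2 := by
  rw [wirtingerBar, h.fderiv]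
  congr 4
  ext i
  simp

theorem Filter.EventuallyEq.wirtinger_eq {φ ψ : CSpace n → ℂ} {z : CSpace n} (h : φ =ᶠ[𝓝 z] ψ)
    (k : Fin n) : wirtinger k φ z = wirtinger k ψ z := by
  simp only [wirtinger, h.fderiv_eq]

theorem Filter.EventuallyEq.wirtingerBar_eq {φ ψ : CSpace n → ℂ} {z : CSpace n}
    (h : φ =ᶠ[𝓝 z] ψ) (k : Fin n) : wirtingerBar k φ z = wirtingerBar k ψ z := by
  simp only [wirtingerBar, h.fderiv_eq]

theorem Filter.EventuallyEq.leviForm_eq {φ ψ : CSpace n → ℝ} {z : CSpace n} (h : φ =ᶠ[𝓝 z] ψ)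
    (v : CSpace n) : leviForm φ z v = leviForm ψ z v := by
  have h1 : (fun w => (φ w : ℂ)) =ᶠ[𝓝 z] fun w => (ψ w : ℂ) := h.fun_comp Complex.ofReal
  have h2 : ∀ l, wirtingerBar l (fun w => (φ w : ℂ)) =ᶠ[𝓝 z] wirtingerBar l fun w => (ψ w : ℂ) :=
    fun l => h1.eventuallyEq_nhds.mono fun w hw => hw.wirtingerBar_eq l
  simp only [leviForm, (h2 _).wirtinger_eq]

theorem one_add_norm_sq_ne_zero (c : ℂ) : 1 + c * conj c ≠ 0 := by
  rw [Complex.mul_conj']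
  exact_mod_cast (by positivity : (1 + ‖c‖ ^ 2 : ℝ) ≠ 0)

theorem wirtingerBar_log_one_add_norm_sq {f : CSpace n → ℂ} {z : CSpace n}
    (hf : DifferentiableAt ℂ f z) (l : Fin n) :
    wirtingerBar l (fun w => (Real.log (1 + ‖f w‖ ^ 2) : ℂ)) z =
      f z * conj (fderiv ℂ f z (EuclideanSpace.single l 1)) * (1 + f z * conj (f z))⁻¹ := by
  have h1 : HasFDerivAt f ((fderiv ℂ f z).restrictScalars ℝ) z :=
    hf.hasFDerivAt.restrictScalars ℝ
  have h2 := (h1.norm_sq.const_add 1).log (by positivity)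
  have h3 := Complex.ofRealCLM.hasFDerivAt.comp z h2
  have h4 := wirtingerBar_eq h3 l
  refine h4.trans ?_
  have h0 := one_add_norm_sq_ne_zero (f z)
  set p := fderiv ℂ f z (EuclideanSpace.single l 1) with hp
  have h5 : ((1 + ‖f z‖ ^ 2 : ℝ) : ℂ) = 1 + f z * conj (f z) := by
    rw [Complex.mul_conj']
    push_cast
    rfl
  simp only [ContinuousLinearMap.comp_apply, ContinuousLinearMap.coe_restrictScalars', map_smul,
    smul_apply, Complex.ofRealCLM_apply, innerSL_apply_apply, ← hp, nsmul_eq_mul, smul_eq_mul,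
    Complex.inner]
  have h6 : ∀ w : ℂ, (w.re : ℂ) = (w + conj w) / 2 := fun w => Complex.re_eq_add_conj w
  simp only [Complex.ofReal_mul, h6, map_mul, Complex.conj_I, Complex.conj_conj, Complex.ofReal_inv,
    h5]
  field_simp
  push_cast
  linear_combination (2 * conj (f z) * p - 2 * f z * conj p) * Complex.I_sq

/-- The second derivatives of `f` enter only through a conjugate, which `∂/∂z_k` annihilates. The
two remaining terms combine over the denominator `(1 + |f|²)²`. -/
theorem wirtinger_wirtingerBar_log_one_add_norm_sq {f : CSpace n → ℂ} {U : Set (CSpace n)}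
    (hU : IsOpen U) (hf : DifferentiableOn ℂ f U) {z : CSpace n} (hz : z ∈ U) (k l : Fin n) :
    wirtinger k (wirtingerBar l fun w => (Real.log (1 + ‖f w‖ ^ 2) : ℂ)) z =
      fderiv ℂ f z (EuclideanSpace.single k 1) *
        conj (fderiv ℂ f z (EuclideanSpace.single l 1)) * ((1 + f z * conj (f z)) ^ 2)⁻¹ := by
  have h0 := one_add_norm_sq_ne_zero (f z)
  have h1 : wirtingerBar l (fun w => (Real.log (1 + ‖f w‖ ^ 2) : ℂ)) =ᶠ[𝓝 z] fun w =>
      f w * conj (fderiv ℂ f w (EuclideanSpace.single l 1)) * (1 + f w * conj (f w))⁻¹ := by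
    filter_upwards [hU.mem_nhds hz] with w hw
    exact wirtingerBar_log_one_add_norm_sq (hf.differentiableAt (hU.mem_nhds hw)) l
  rw [h1.wirtinger_eq]
  have hfz : HasFDerivAt f ((fderiv ℂ f z).restrictScalars ℝ) z :=
    (hf.differentiableAt (hU.mem_nhds hz)).hasFDerivAt.restrictScalars ℝ
  have hgz := ((differentiableAt_fderiv_apply hU hf hz
    (EuclideanSpace.single l 1)).hasFDerivAt.restrictScalars ℝ)
  have hcf := (Complex.conjCLE : ℂ →L[ℝ] ℂ).hasFDerivAt.comp z hfz
  have hcg := (Complex.conjCLE : ℂ →L[ℝ] ℂ).hasFDerivAt.comp z hgz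
  have hinv := ((hasDerivAt_inv h0).hasFDerivAt.restrictScalars ℝ).comp z
    ((hfz.mul hcf).const_add 1)
  have h := (hfz.mul hcg).mul hinv
  refine (wirtinger_eq h k).trans ?_
  set p := fderiv ℂ f z (EuclideanSpace.single k 1) with hp
  set q := fderiv ℂ f z (EuclideanSpace.single l 1) with hq
  set q' := fderiv ℂ (fun w => fderiv ℂ f w (EuclideanSpace.single l 1)) z
    (EuclideanSpace.single k 1) with hq'
  simp only [ContinuousLinearMap.comp_apply, ContinuousLinearMap.coe_restrictScalars', map_smul,
    smul_apply, add_apply, ← hp, ← hq, ← hq', smul_eq_mul, Function.comp_apply,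
    ContinuousLinearMap.toSpanSingleton_apply, ContinuousLinearEquiv.coe_coe,
    Complex.conjCLE_apply, map_mul, Complex.conj_I, Pi.mul_apply]
  field_simp
  rw [Complex.I_sq]
  ring

theorem leviForm_log_one_add_norm_sq {f : CSpace n → ℂ} {U : Set (CSpace n)}
    (hU : IsOpen U) (hf : DifferentiableOn ℂ f U) {z : CSpace n} (hz : z ∈ U) (v : CSpace n) :
    leviForm (fun w => Real.log (1 + ‖f w‖ ^ 2)) z v =
      ‖fderiv ℂ f z v‖ ^ 2 / (1 + ‖f z‖ ^ 2) ^ 2 := by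
  have hv : fderiv ℂ f z v = ∑ k, fderiv ℂ f z (EuclideanSpace.single k 1) * v k := by
    conv_lhs => rw [← (EuclideanSpace.basisFun (Fin n) ℂ).sum_repr v]
    simp [mul_comm]
  have h : ∑ k, ∑ l, wirtinger k (wirtingerBar l fun w => (Real.log (1 + ‖f w‖ ^ 2) : ℂ)) z *
      v k * conj (v l) = ((‖fderiv ℂ f z v‖ ^ 2 / (1 + ‖f z‖ ^ 2) ^ 2 : ℝ) : ℂ) := by
    push_cast
    rw [← Complex.mul_conj', ← Complex.mul_conj', hv, map_sum, Finset.sum_mul_sum, Finset.sum_div]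
    refine Finset.sum_congr rfl fun k _ => ?_
    rw [Finset.sum_div]
    refine Finset.sum_congr rfl fun l _ => ?_
    rw [wirtinger_wirtingerBar_log_one_add_norm_sq hU hf hz, map_mul]
    ring
  rw [leviForm, h, Complex.ofReal_re]

theorem leviForm_log_kernel {c : ℝ} (hc : 0 < c) {z : CSpace n} (hz : z ∈ unitBall n)
    (v : CSpace n) :
    leviForm (fun w => Real.log (c * ((1 - ‖w‖ ^ 2) ^ (n + 1))⁻¹)) z v =
      (n + 1) * (‖v‖ ^ 2 / (1 - ‖z‖ ^ 2) + ‖⟪z, v⟫_ℂ‖ ^ 2 / (1 - ‖z‖ ^ 2) ^ 2) := by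
  have hρ : ∀ w ∈ unitBall n, 0 < 1 - ‖w‖ ^ 2 := fun w hw => by
    linarith [norm_sq_lt_one_of_mem_unitBall hw]
  have hρ' : ∀ w ∈ unitBall n, 1 - (‖w‖ ^ 2 : ℂ) ≠ 0 := fun w hw => by
    exact_mod_cast (hρ w hw).ne'
  -- The real differential of `|w|²` sees the real and imaginary parts of `w l`, which the Wirtinger
  -- operators reassemble.
  have hre : ∀ (w : CSpace n) (l : Fin n),
      ⟪w, EuclideanSpace.single l (1 : ℂ)⟫_ℝ = (w l).re ∧
      ⟪w, Complex.I • EuclideanSpace.single l (1 : ℂ)⟫_ℝ = (w l).im := by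
    intro w l
    simp [PiLp.inner_apply, Complex.inner, apply_ite Complex.re]
  have h1 : ∀ w ∈ unitBall n, ∀ l, wirtingerBar l
      (fun w => (Real.log (c * ((1 - ‖w‖ ^ 2) ^ (n + 1))⁻¹) : ℂ)) w =
        (n + 1) * (w l * (1 - (‖w‖ ^ 2 : ℂ))⁻¹) := by
    intro w hw l
    have hne := hρ' w hw
    have hne' := hρ w hw
    have hlog : (fun w : CSpace n => (Real.log (c * ((1 - ‖w‖ ^ 2) ^ (n + 1))⁻¹) : ℂ)) =ᶠ[𝓝 w]
        fun w => ((Real.log c - (n + 1) * Real.log (1 - ‖w‖ ^ 2) : ℝ) : ℂ) := by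
      filter_upwards [isOpen_ball.mem_nhds hw] with y hy
      have := hρ y hy
      rw [Real.log_mul hc.ne' (by positivity), Real.log_inv, Real.log_pow]
      push_cast
      ring
    rw [hlog.wirtingerBar_eq]
    have h2 := ((((hasStrictFDerivAt_norm_sq w).hasFDerivAt.const_sub 1).log
      hne'.ne').const_mul (n + 1 : ℝ)).const_sub (Real.log c)
    refine (wirtingerBar_eq (Complex.ofRealCLM.hasFDerivAt.comp w h2) l).trans ?_
    simp only [ContinuousLinearMap.comp_apply, smul_apply, neg_apply, Complex.ofRealCLM_apply,
      innerSL_apply_apply, (hre w l).1, (hre w l).2, nsmul_eq_mul, smul_eq_mul]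
    push_cast
    field_simp
    rw [mul_comm, Complex.re_add_im]
  have h2 : ∀ k l, wirtinger k (wirtingerBar l
      (fun w => (Real.log (c * ((1 - ‖w‖ ^ 2) ^ (n + 1))⁻¹) : ℂ))) z =
        (n + 1) * ((if k = l then 1 else 0) * (1 - (‖z‖ ^ 2 : ℂ))⁻¹ +
          z l * conj (z k) * ((1 - (‖z‖ ^ 2 : ℂ)) ^ 2)⁻¹) := by
    intro k l
    have hne := hρ' z hz
    have h3 := Filter.mem_of_superset (isOpen_ball.mem_nhds hz) fun w hw => h1 w hw l
    rw [Filter.EventuallyEq.wirtinger_eq h3]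
    have h4 : HasFDerivAt (fun w : CSpace n => w l)
        ((EuclideanSpace.proj l : CSpace n →L[ℂ] ℂ).restrictScalars ℝ) z :=
      (EuclideanSpace.proj l : CSpace n →L[ℂ] ℂ).hasFDerivAt.restrictScalars ℝ
    have h5 := (Complex.ofRealCLM.hasFDerivAt.comp z
      (hasStrictFDerivAt_norm_sq z).hasFDerivAt).const_sub 1
    have hne5 : 1 - (Complex.ofRealCLM ∘ fun w : CSpace n => ‖w‖ ^ 2) z ≠ 0 := by
      simpa using hne
    have h6 := ((hasDerivAt_inv hne5).hasFDerivAt.restrictScalars ℝ).comp z h5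
    have h7 := (h4.mul h6).const_mul (n + 1 : ℂ)
    have h8 : (fun w : CSpace n => (n + 1 : ℂ) * (w l * (1 - (‖w‖ ^ 2 : ℂ))⁻¹)) =
        fun w => (n + 1 : ℂ) * ((fun w : CSpace n => w l) * ((fun x => x⁻¹) ∘ fun w : CSpace n =>
          1 - (Complex.ofRealCLM ∘ fun w : CSpace n => ‖w‖ ^ 2) w)) w := by
      ext w
      simp
    rw [h8, wirtinger_eq h7 k]
    have h9 : conj (z k) = (z k).re - (z k).im * Complex.I :=
      Complex.ext (by simp) (by simp)
    simp only [ContinuousLinearMap.comp_apply, ContinuousLinearMap.coe_restrictScalars', map_smul,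
      smul_apply, add_apply, neg_apply, smul_eq_mul, Function.comp_apply, nsmul_eq_mul,
      ContinuousLinearMap.toSpanSingleton_apply, innerSL_apply_apply, (hre z k).1, (hre z k).2,
      Complex.ofRealCLM_apply, PiLp.proj_apply, PiLp.single_apply, h9]
    push_cast
    rcases eq_or_ne k l with rfl | hkl
    · simp only [if_true]
      field_simp
      linear_combination (-(1 - (‖z‖ ^ 2 : ℂ))) * Complex.I_sq
    · simp only [if_neg hkl, if_neg hkl.symm]
      field_simp
      ring
  have h : ∑ k, ∑ l, wirtinger k (wirtingerBar l
      (fun w => (Real.log (c * ((1 - ‖w‖ ^ 2) ^ (n + 1))⁻¹) : ℂ))) z * v k * conj (v l) =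
      ((((n : ℝ) + 1) * (‖v‖ ^ 2 / (1 - ‖z‖ ^ 2) + ‖⟪z, v⟫_ℂ‖ ^ 2 / (1 - ‖z‖ ^ 2) ^ 2) : ℝ) : ℂ) := by
    have hv : ((‖v‖ ^ 2 : ℝ) : ℂ) = ∑ k, ∑ l, (if k = l then 1 else 0) * (v k * conj (v l)) := by
      rw [← inner_self_eq_ofReal_norm_sq, PiLp.inner_apply]
      simp [Complex.mul_conj']
    have hzv : ((‖⟪z, v⟫_ℂ‖ ^ 2 : ℝ) : ℂ) =
        ∑ k, ∑ l, (z l * conj (z k)) * (v k * conj (v l)) := by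
      rw [Complex.ofReal_pow, ← Complex.mul_conj', PiLp.inner_apply, map_sum, Finset.sum_mul_sum]
      refine Finset.sum_congr rfl fun k _ => Finset.sum_congr rfl fun l _ => ?_
      simp
      ring
    rw [Complex.ofReal_mul, Complex.ofReal_add (_ / _), Complex.ofReal_div, Complex.ofReal_div, hv,
      hzv, Finset.sum_div, Finset.sum_div, ← Finset.sum_add_distrib, Finset.mul_sum]
    refine Finset.sum_congr rfl fun k _ => ?_
    rw [Finset.sum_div, Finset.sum_div, ← Finset.sum_add_distrib, Finset.mul_sum]
    refine Finset.sum_congr rfl fun l _ => ?_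
    rw [h2]
    push_cast
    ring
  rw [leviForm, h, Complex.ofReal_re]

end

/-! ### Integrals over the ball -/

section

variable {n : ℕ}

/-- The real determinant of a complex-linear map is the norm from `ℂ` to `ℝ` of its complex
determinant. -/
theorem ofReal_abs_det_restrictScalars (L : CSpace n →L[ℂ] CSpace n) :
    ENNReal.ofReal |(L.restrictScalars ℝ).det| =
      ‖LinearMap.det (L : CSpace n →ₗ[ℂ] CSpace n)‖ₑ ^ 2 := by
  have h : (L.restrictScalars ℝ).det =
      ‖LinearMap.det (L : CSpace n →ₗ[ℂ] CSpace n)‖ ^ 2 := by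
    rw [← Complex.normSq_eq_norm_sq, ← Algebra.norm_complex_apply, ← LinearMap.det_restrictScalars]
    rfl
  rw [h, abs_of_nonneg (by positivity), ← ofReal_norm, ENNReal.ofReal_pow (norm_nonneg _)]

/-- The change of variables formula for holomorphic bijections. -/
theorem setLIntegral_eq_of_bijOn {Ω : Set (CSpace n)} (hΩ : IsOpen Ω) {g : CSpace n → CSpace n}
    {g' : CSpace n → CSpace n →L[ℂ] CSpace n} (hg : ∀ z ∈ Ω, HasFDerivAt g (g' z) z)
    (hbij : Set.BijOn g Ω Ω) (F : CSpace n → ℝ≥0∞) :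
    ∫⁻ z in Ω, F z =
      ∫⁻ z in Ω, ‖LinearMap.det (g' z : CSpace n →ₗ[ℂ] CSpace n)‖ₑ ^ 2 * F (g z) := by
  have h := lintegral_image_eq_lintegral_abs_det_fderiv_mul volume hΩ.measurableSet
    (fun z hz => ((hg z hz).restrictScalars ℝ).hasFDerivWithinAt) hbij.injOn F
  rw [hbij.image_eq] at h
  rw [h]
  simp only [ofReal_abs_det_restrictScalars]

theorem smul_mem_unitBall {c : ℂ} (hc : ‖c‖ ≤ 1) {z : CSpace n} (hz : z ∈ unitBall n) :
    c • z ∈ unitBall n := by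
  rw [mem_ball_zero_iff] at hz ⊢
  rw [norm_smul]
  nlinarith [norm_nonneg z]

theorem setLIntegral_comp_smul {c : ℂ} (hc : ‖c‖ = 1) (F : CSpace n → ℝ≥0∞) :
    ∫⁻ z in unitBall n, F (c • z) = ∫⁻ z in unitBall n, F z := by
  have hc0 : c ≠ 0 := norm_ne_zero_iff.1 (by simp [hc])
  have hbij : Set.BijOn (fun z : CSpace n => c • z) (unitBall n) (unitBall n) :=
    Set.InvOn.bijOn (f' := fun z => c⁻¹ • z)
      ⟨fun z _ => inv_smul_smul₀ hc0 z, fun z _ => smul_inv_smul₀ hc0 z⟩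
      (fun z hz => smul_mem_unitBall hc.le hz)
      (fun z hz => smul_mem_unitBall (by simp [hc]) hz)
  have h := setLIntegral_eq_of_bijOn isOpen_ball (g' := fun _ => c • ContinuousLinearMap.id ℂ _)
    (fun z _ => (hasFDerivAt_id (𝕜 := ℂ) z).const_smul c) hbij F
  rw [h]
  simp [enorm_eq_nnnorm, LinearMap.det_smul, ContinuousLinearMap.coe_id,
    show ‖c‖₊ = 1 from NNReal.eq hc]

/-- Mean value property of the holomorphic function `ζ ↦ f (ζ z)²`; squaring first avoids
Cauchy–Schwarz. -/
theorem enorm_sq_zero_le_lintegral_circle {f : CSpace n → ℂ}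
    (hf : DifferentiableOn ℂ f (unitBall n)) {z : CSpace n} (hz : z ∈ unitBall n) :
    ‖f 0‖ₑ ^ 2 ≤ ENNReal.ofReal (2 * Real.pi)⁻¹ *
      ∫⁻ θ in Set.Ioc 0 (2 * Real.pi), ‖f (circleMap 0 1 θ • z)‖ₑ ^ 2 := by
  have hd : DifferentiableOn ℂ (fun ζ : ℂ => f (ζ • z) ^ 2) (closedBall 0 1) := by
    intro ζ hζ
    have h1 : DifferentiableAt ℂ f (ζ • z) := hf.differentiableAt
      (isOpen_ball.mem_nhds (smul_mem_unitBall (by simpa using hζ) hz))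
    have h2 : DifferentiableAt ℂ (fun ζ : ℂ => ζ • z) ζ := by fun_prop
    exact ((h1.comp ζ h2).pow 2).differentiableWithinAt
  have hd' : DiffContOnCl ℂ (fun ζ : ℂ => f (ζ • z) ^ 2) (ball 0 |1|) := by
    rw [abs_one]
    refine DifferentiableOn.diffContOnCl ?_
    rwa [closure_ball _ one_ne_zero]
  have h := hd'.circleAverage
  rw [Real.circleAverage_def, intervalIntegral.integral_of_le Real.two_pi_pos.le] at h
  have h3 : ‖f 0‖ₑ ^ 2 = ‖f ((0 : ℂ) • z) ^ 2‖ₑ := by simp [enorm_pow]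
  rw [h3, ← h, enorm_smul, Real.enorm_eq_ofReal (by positivity)]
  gcongr
  refine (enorm_integral_le_lintegral_enorm _).trans_eq ?_
  simp [enorm_pow]

/-- The value at the centre of a holomorphic function is at most its quadratic mean. -/
theorem enorm_sq_zero_mul_volume_le {f : CSpace n → ℂ}
    (hf : DifferentiableOn ℂ f (unitBall n)) :
    ‖f 0‖ₑ ^ 2 * volume (unitBall n) ≤ ∫⁻ z in unitBall n, ‖f z‖ₑ ^ 2 := by
  -- Outside the ball `f` is arbitrary; extension by zero gives the global measurability that
  -- Tonelli needs. The circle average is then removed by rotation invariance.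
  set g : CSpace n → ℂ := (unitBall n).indicator f with hgdef
  have hgf : Set.EqOn g f (unitBall n) := fun z hz => Set.indicator_of_mem hz f
  have hg : DifferentiableOn ℂ g (unitBall n) := hf.congr hgf
  have hgm : Measurable g := by
    classical
    rw [hgdef, ← Set.piecewise_eq_indicator]
    exact hf.continuousOn.measurable_piecewise continuousOn_const measurableSet_ball
  rw [← hgf zero_mem_unitBall, ← setLIntegral_const]
  have hsm : Measurable fun p : CSpace n × ℝ => ‖g (circleMap 0 1 p.2 • p.1)‖ₑ ^ 2 := by
    refine ((hgm.comp ?_).enorm).pow_const 2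
    exact (((continuous_circleMap 0 1).comp continuous_snd).smul continuous_fst).measurable
  calc ∫⁻ _ in unitBall n, ‖g 0‖ₑ ^ 2
      ≤ ∫⁻ z in unitBall n, ENNReal.ofReal (2 * Real.pi)⁻¹ *
          ∫⁻ θ in Set.Ioc 0 (2 * Real.pi), ‖g (circleMap 0 1 θ • z)‖ₑ ^ 2 :=
        setLIntegral_mono' measurableSet_ball fun z hz => enorm_sq_zero_le_lintegral_circle hg hz
    _ = ENNReal.ofReal (2 * Real.pi)⁻¹ * ∫⁻ θ in Set.Ioc 0 (2 * Real.pi),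
          ∫⁻ z in unitBall n, ‖g (circleMap 0 1 θ • z)‖ₑ ^ 2 := by
        rw [lintegral_const_mul' _ _ ENNReal.ofReal_ne_top, lintegral_lintegral_swap]
        exact hsm.aemeasurable
    _ = ENNReal.ofReal (2 * Real.pi)⁻¹ * ∫⁻ θ in Set.Ioc 0 (2 * Real.pi),
          ∫⁻ z in unitBall n, ‖g z‖ₑ ^ 2 := by
        congr 2
        ext θ
        exact setLIntegral_comp_smul (c := circleMap 0 1 θ) (by simp) fun z => ‖g z‖ₑ ^ 2
    _ = ∫⁻ z in unitBall n, ‖g z‖ₑ ^ 2 := by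
        rw [setLIntegral_const, Real.volume_Ioc, sub_zero, mul_comm, mul_assoc,
          ← ENNReal.ofReal_mul Real.two_pi_pos.le, mul_inv_cancel₀ Real.two_pi_pos.ne']
        simp
    _ = ∫⁻ z in unitBall n, ‖f z‖ₑ ^ 2 :=
        setLIntegral_congr_fun measurableSet_ball fun z hz => by simp only [hgf hz]

theorem setLIntegral_comp_ballInvolution {a : CSpace n} (ha : a ∈ unitBall n)
    (F : CSpace n → ℝ≥0∞) :
    ∫⁻ z in unitBall n, F z =
      ∫⁻ z in unitBall n, ‖ballInvolutionJacobian a z‖ₑ ^ 2 * F (ballInvolution a z) := by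
  rw [setLIntegral_eq_of_bijOn isOpen_ball (fun z hz => hasFDerivAt_ballInvolution ha hz)
    (bijOn_ballInvolution ha)]
  exact setLIntegral_congr_fun measurableSet_ball fun z hz => by
    simp only [det_ballInvolutionDeriv ha hz]

/-- The central estimate is applied to the Jacobian times `f ∘ ballInvolution a`, which has the same
`L²` norm as `f`. -/
theorem enorm_sq_mul_volume_le {f : CSpace n → ℂ} (hf : DifferentiableOn ℂ f (unitBall n))
    {a : CSpace n} (ha : a ∈ unitBall n) :
    ENNReal.ofReal ((1 - ‖a‖ ^ 2) ^ (n + 1)) * ‖f a‖ₑ ^ 2 * volume (unitBall n) ≤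
      ∫⁻ z in unitBall n, ‖f z‖ₑ ^ 2 := by
  have h1 : DifferentiableOn ℂ (fun z => ballInvolutionJacobian a z * f (ballInvolution a z))
      (unitBall n) :=
    (differentiableOn_ballInvolutionJacobian ha).mul
      (hf.comp (isAutomorphism_ballInvolution ha).1 fun z hz => ballInvolution_mem ha hz)
  have h2 := enorm_sq_zero_mul_volume_le h1
  rw [setLIntegral_comp_ballInvolution ha]
  refine le_trans (le_of_eq ?_) (h2.trans_eq ?_)
  · rw [ballInvolution_zero, enorm_mul, mul_pow, ← norm_sq_ballInvolutionJacobian_zero ha,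
      ENNReal.ofReal_pow (norm_nonneg _), ofReal_norm]
  · simp only [enorm_mul, mul_pow]

end

/-! ### The Bergman kernel of the ball -/

section

variable {n : ℕ}

/-- The value `K(a, a)` of the Bergman kernel of the ball in closed form. -/
def ballKernel {n : ℕ} (a : CSpace n) : ℝ :=
  (volume.real (unitBall n))⁻¹ * ((1 - ‖a‖ ^ 2) ^ (n + 1))⁻¹

theorem volume_real_unitBall_pos : 0 < volume.real (unitBall n) :=
  ENNReal.toReal_pos (measure_ball_pos _ _ one_pos).ne' measure_ball_lt_top.ne

theorem ballKernel_pos {a : CSpace n} (ha : a ∈ unitBall n) : 0 < ballKernel a := by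
  have h1 : 0 < 1 - ‖a‖ ^ 2 := by linarith [norm_sq_lt_one_of_mem_unitBall ha]
  have h2 := volume_real_unitBall_pos (n := n)
  unfold ballKernel
  positivity

theorem differentiableOn_bergmanRep (u : bergmanSpace (unitBall n)) :
    DifferentiableOn ℂ (bergmanRep u) (unitBall n) :=
  u.2.choose_spec.1

theorem ae_eq_bergmanRep (u : bergmanSpace (unitBall n)) :
    (u : Lp ℂ 2 (volume.restrict (unitBall n))) =ᵐ[volume.restrict (unitBall n)] bergmanRep u :=
  u.2.choose_spec.2

theorem enorm_sq_eq_lintegral {α : Type*} [MeasurableSpace α] {μ : Measure α} (u : Lp ℂ 2 μ)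
    {f : α → ℂ} (h : u =ᵐ[μ] f) : ‖u‖ₑ ^ 2 = ∫⁻ x, ‖f x‖ₑ ^ 2 ∂μ := by
  have h1 : ‖u‖ₑ = eLpNorm f 2 μ := by rw [Lp.enorm_def, eLpNorm_congr_ae h]
  rw [h1, eLpNorm_eq_lintegral_rpow_enorm_toReal two_ne_zero ENNReal.ofNat_ne_top,
    ← ENNReal.rpow_natCast, ← ENNReal.rpow_mul]
  simp

/-- Point evaluations are bounded on the Bergman space of the ball. -/
theorem norm_sq_le_ballKernel_mul {u : Lp ℂ 2 (volume.restrict (unitBall n))} {f : CSpace n → ℂ}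
    (hf : DifferentiableOn ℂ f (unitBall n)) (hu : u =ᵐ[volume.restrict (unitBall n)] f)
    {a : CSpace n} (ha : a ∈ unitBall n) : ‖f a‖ ^ 2 ≤ ballKernel a * ‖u‖ ^ 2 := by
  have h := enorm_sq_mul_volume_le hf ha
  rw [← enorm_sq_eq_lintegral u hu] at h
  have h1 : 0 < 1 - ‖a‖ ^ 2 := by linarith [norm_sq_lt_one_of_mem_unitBall ha]
  have h2 := volume_real_unitBall_pos (n := n)
  have h3 := ENNReal.toReal_mono (by simp) h
  rw [ENNReal.toReal_mul, ENNReal.toReal_mul, ENNReal.toReal_ofReal (by positivity),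
    ENNReal.toReal_pow, ENNReal.toReal_pow, toReal_enorm, toReal_enorm] at h3
  change _ * volume.real (unitBall n) ≤ _ at h3
  rw [ballKernel, ← mul_inv, inv_mul_eq_div, le_div_iff₀ (by positivity)]
  linarith

/-- The difference of two representatives represents the class `0`, so the pointwise bound makes it
vanish everywhere. Hence the chosen representatives depend linearly on the class. -/
theorem bergmanRep_eqOn {u : bergmanSpace (unitBall n)} {f : CSpace n → ℂ}
    (hf : DifferentiableOn ℂ f (unitBall n))
    (hu : (u : Lp ℂ 2 (volume.restrict (unitBall n))) =ᵐ[volume.restrict (unitBall n)] f) :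
    Set.EqOn (bergmanRep u) f (unitBall n) := by
  intro a ha
  have h1 : ((0 : Lp ℂ 2 (volume.restrict (unitBall n))) : CSpace n → ℂ)
      =ᵐ[volume.restrict (unitBall n)] bergmanRep u - f := by
    filter_upwards [Lp.coeFn_zero ℂ 2 (volume.restrict (unitBall n)), ae_eq_bergmanRep u, hu]
      with x h0 h1 h2
    refine h0.trans ?_
    simp [← h1, ← h2]
  have h2 := norm_sq_le_ballKernel_mul ((differentiableOn_bergmanRep u).sub hf) h1 ha
  have h3 : ‖bergmanRep u a - f a‖ ^ 2 ≤ 0 := by simpa using h2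
  have h4 : ‖bergmanRep u a - f a‖ = 0 := by
    nlinarith [norm_nonneg (bergmanRep u a - f a)]
  exact sub_eq_zero.1 (norm_eq_zero.1 h4)

theorem bergmanRep_add (u v : bergmanSpace (unitBall n)) {a : CSpace n} (ha : a ∈ unitBall n) :
    bergmanRep (u + v) a = bergmanRep u a + bergmanRep v a :=
  bergmanRep_eqOn ((differentiableOn_bergmanRep u).add (differentiableOn_bergmanRep v))
    ((Lp.coeFn_add _ _).trans ((ae_eq_bergmanRep u).add (ae_eq_bergmanRep v))) ha

theorem bergmanRep_smul (c : ℂ) (u : bergmanSpace (unitBall n)) {a : CSpace n}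
    (ha : a ∈ unitBall n) : bergmanRep (c • u) a = c * bergmanRep u a :=
  bergmanRep_eqOn (f := c • bergmanRep u) ((differentiableOn_bergmanRep u).const_smul c)
    ((Lp.coeFn_smul _ _).trans ((ae_eq_bergmanRep u).const_smul c)) ha

theorem norm_bergmanRep_le (u : bergmanSpace (unitBall n)) {a : CSpace n}
    (ha : a ∈ unitBall n) : ‖bergmanRep u a‖ ≤ √(ballKernel a) * ‖u‖ := by
  have h := norm_sq_le_ballKernel_mul (differentiableOn_bergmanRep u) (ae_eq_bergmanRep u) ha
  refine le_of_sq_le_sq ?_ (by positivity)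
  rw [mul_pow, Real.sq_sqrt (ballKernel_pos ha).le]
  exact h

/-- Evaluation at a point of the ball, as a functional on the Bergman space. -/
def bergmanEval {a : CSpace n} (ha : a ∈ unitBall n) : bergmanSpace (unitBall n) →L[ℂ] ℂ :=
  LinearMap.mkContinuous (σ := RingHom.id ℂ)
    { toFun := fun u => bergmanRep u a
      map_add' := fun u v => bergmanRep_add u v ha
      map_smul' := fun c u => bergmanRep_smul c u ha }
    (√(ballKernel a)) fun u => norm_bergmanRep_le u ha

theorem memLp_ballInvolutionJacobian {a : CSpace n} (ha : a ∈ unitBall n) :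
    MemLp (ballInvolutionJacobian a) 2 (volume.restrict (unitBall n)) := by
  refine ⟨(differentiableOn_ballInvolutionJacobian ha).continuousOn.aestronglyMeasurable
    measurableSet_ball, ?_⟩
  rw [eLpNorm_lt_top_iff_lintegral_rpow_enorm_lt_top two_ne_zero ENNReal.ofNat_ne_top]
  have h := setLIntegral_comp_ballInvolution ha 1
  simp only [Pi.one_apply, mul_one, lintegral_one, Measure.restrict_apply_univ] at h
  simpa [← h] using measure_ball_lt_top (μ := (volume : Measure (CSpace n)))

/-- The Jacobian is extremal: its squared `L²` norm is the volume of the ball, by change of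
variables with integrand 1. -/
theorem norm_sq_bergmanEval {a : CSpace n} (ha : a ∈ unitBall n) :
    ‖bergmanEval ha‖ ^ 2 = ballKernel a := by
  apply le_antisymm
  · have h : ‖bergmanEval ha‖ ≤ √(ballKernel a) :=
      (bergmanEval ha).opNorm_le_bound (Real.sqrt_nonneg _) fun u => norm_bergmanRep_le u ha
    calc ‖bergmanEval ha‖ ^ 2 ≤ √(ballKernel a) ^ 2 := by gcongr
      _ = ballKernel a := Real.sq_sqrt (ballKernel_pos ha).le
  · have hJ := memLp_ballInvolutionJacobian ha
    have hd := differentiableOn_ballInvolutionJacobian ha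
    let u : bergmanSpace (unitBall n) := ⟨hJ.toLp _, _, hd, hJ.coeFn_toLp⟩
    have h1 : bergmanEval ha u = ballInvolutionJacobian a a :=
      bergmanRep_eqOn (u := u) hd hJ.coeFn_toLp ha
    have h2 : ‖u‖ ^ 2 = volume.real (unitBall n) := by
      have h3 := enorm_sq_eq_lintegral (hJ.toLp _) hJ.coeFn_toLp
      have h4 := setLIntegral_comp_ballInvolution ha 1
      simp only [Pi.one_apply, mul_one, lintegral_one, Measure.restrict_apply_univ] at h4
      rw [← h4] at h3
      have h5 := congrArg ENNReal.toReal h3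
      rw [ENNReal.toReal_pow, toReal_enorm] at h5
      exact h5
    have h6 := pow_le_pow_left₀ (norm_nonneg _) ((bergmanEval ha).le_opNorm u) 2
    rw [h1, norm_sq_ballInvolutionJacobian_self ha, mul_pow, h2] at h6
    have h7 := volume_real_unitBall_pos (n := n)
    rw [ballKernel, inv_mul_eq_div, div_le_iff₀ h7]
    exact h6

theorem ballKernel_le_of_norm_le {a : CSpace n} {t : ℝ} (ht : t < 1) (ha : ‖a‖ ≤ t) :
    ballKernel a ≤ (volume.real (unitBall n))⁻¹ * ((1 - t ^ 2) ^ (n + 1))⁻¹ := by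
  have h0 := norm_nonneg a
  have h1 : 0 < 1 - t ^ 2 := by nlinarith
  have h2 := volume_real_unitBall_pos (n := n)
  unfold ballKernel
  gcongr

/-- Since the kernel is locally bounded, `L²` convergence makes the representatives locally
uniformly Cauchy. Their limit is holomorphic, and an a.e. convergent subsequence identifies it with
the `L²` limit. The resulting completeness is needed for Riesz representation and Parseval. -/
theorem isClosed_bergmanSpace : IsClosed (bergmanSpace (unitBall n) :
    Set (Lp ℂ 2 (volume.restrict (unitBall n)))) := by
  refine IsSeqClosed.isClosed fun u u₀ hu hu₀ => ?_
  choose f hf huf using hu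
  have hsub : ∀ k l, ∀ a ∈ unitBall n, ‖f k a - f l a‖ ^ 2 ≤ ballKernel a * ‖u k - u l‖ ^ 2 :=
    fun k l a ha => norm_sq_le_ballKernel_mul ((hf k).sub (hf l))
      ((Lp.coeFn_sub _ _).trans ((huf k).sub (huf l))) ha
  have hball : ∀ x ∈ unitBall n, ball x ((1 - ‖x‖) / 2) ⊆ unitBall n ∧
      UniformCauchySeqOn f atTop (ball x ((1 - ‖x‖) / 2)) := by
    intro x hx
    have hx1 : ‖x‖ < 1 := by simpa using hx
    have hnorm : ∀ a ∈ ball x ((1 - ‖x‖) / 2), ‖a‖ ≤ (1 + ‖x‖) / 2 := by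
      intro a ha
      rw [mem_ball_iff_norm] at ha
      linarith [norm_sub_norm_le a x]
    have hsubset : ball x ((1 - ‖x‖) / 2) ⊆ unitBall n := fun a ha => by
      rw [mem_ball_zero_iff]
      linarith [hnorm a ha]
    refine ⟨hsubset, ?_⟩
    obtain ⟨κ, hκ0, hκ⟩ : ∃ κ : ℝ, 0 < κ ∧ ∀ a ∈ ball x ((1 - ‖x‖) / 2), ballKernel a ≤ κ ^ 2 := by
      set κ := (volume.real (unitBall n))⁻¹ * ((1 - ((1 + ‖x‖) / 2) ^ 2) ^ (n + 1))⁻¹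
      refine ⟨√κ + 1, by positivity, fun a ha => ?_⟩
      have h1 := ballKernel_le_of_norm_le (by linarith) (hnorm a ha)
      have h2 : 0 ≤ κ := (ballKernel_pos (hsubset ha)).le.trans h1
      have := Real.sq_sqrt h2
      have := Real.sqrt_nonneg κ
      nlinarith
    rw [Metric.uniformCauchySeqOn_iff]
    intro ε hε
    obtain ⟨N, hN⟩ := Metric.cauchySeq_iff.1 hu₀.cauchySeq (ε / κ) (by positivity)
    refine ⟨N, fun k hk l hl a ha => ?_⟩
    have h1 := hN k hk l hl
    rw [dist_eq_norm, lt_div_iff₀ hκ0] at h1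
    rw [dist_eq_norm]
    refine lt_of_le_of_lt (le_of_sq_le_sq ?_ (by positivity)) h1
    rw [mul_pow, mul_comm]
    exact (hsub k l a (hsubset ha)).trans
      (mul_le_mul_of_nonneg_right (hκ a ha) (by positivity))
  have hlim : ∀ a ∈ unitBall n, ∃ y, Tendsto (fun k => f k a) atTop (𝓝 y) := by
    intro a ha
    have ha1 : ‖a‖ < 1 := by simpa using ha
    exact cauchySeq_tendsto_of_complete ((hball a ha).2.cauchySeq (mem_ball_self (by linarith)))
  choose! g hg using hlim
  refine ⟨g, fun x hx => ?_, ?_⟩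
  · have hx1 : ‖x‖ < 1 := by simpa using hx
    exact (differentiableAt_of_tendstoUniformlyOn_ball (by linarith)
      (fun k => (hf k).mono (hball x hx).1) ((hball x hx).2.tendstoUniformlyOn_of_tendsto
        fun a ha => hg a ((hball x hx).1 ha))).differentiableWithinAt
  · obtain ⟨s, hs, hae⟩ := (tendstoInMeasure_of_tendsto_Lp hu₀).exists_seq_tendsto_ae
    filter_upwards [hae, ae_all_iff.2 huf, ae_restrict_mem measurableSet_ball] with x h1 h2 h3
    refine tendsto_nhds_unique h1 ?_
    simp only [h2]
    exact (hg x h3).comp hs.tendsto_atTop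

instance completeSpace_bergmanSpace : CompleteSpace (bergmanSpace (unitBall n)) :=
  isClosed_bergmanSpace.completeSpace_coe

/-- Parseval's identity for a bounded functional and a complete orthonormal system. -/
theorem tsum_apply_mul_conj_of_maximal_orthonormal {H : Type*} [NormedAddCommGroup H]
    [InnerProductSpace ℂ H] [CompleteSpace H] {S : Set H}
    (hS : Orthonormal ℂ ((↑) : S → H))
    (hmax : ∀ T, S ⊆ T → Orthonormal ℂ ((↑) : T → H) → T = S) (φ : H →L[ℂ] ℂ) :
    ∑' u : S, φ u * conj (φ u) = ((‖φ‖ ^ 2 : ℝ) : ℂ) := by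
  have hbot : (Submodule.span ℂ (Set.range ((↑) : S → H)))ᗮ = ⊥ := by
    rw [Subtype.range_coe]
    exact (maximal_orthonormal_iff_orthogonalComplement_eq_bot hS).1 hmax
  set b := HilbertBasis.mkOfOrthogonalEqBot hS hbot with hb
  -- With `k` the Riesz vector of `φ`, the sum is Parseval's expansion of `‖k‖² = ‖φ‖²`.
  set k := (InnerProductSpace.toDual ℂ H).symm φ with hk
  have h := b.tsum_inner_mul_inner k k
  rw [inner_self_eq_norm_sq_to_K, hk, LinearIsometryEquiv.norm_map, ← hk] at h
  refine Eq.trans (tsum_congr fun i => ?_) (h.trans (by simp))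
  rw [← inner_conj_symm (b i) k, hk, InnerProductSpace.toDual_symm_apply, hb,
    HilbertBasis.coe_mkOfOrthogonalEqBot]

/-- The Bergman kernel of the ball on the diagonal. -/
theorem bergmanKernel_unitBall_self {a : CSpace n} (ha : a ∈ unitBall n) :
    bergmanKernel (unitBall n) a a = ballKernel a := by
  have h := (exists_complete_orthonormal_system (unitBall n)).choose_spec
  have h1 := tsum_apply_mul_conj_of_maximal_orthonormal (S := bergmanSystem (unitBall n)) h.1 h.2
    (bergmanEval ha)
  rwa [norm_sq_bergmanEval] at h1

theorem bergmanMetric_unitBall {z : CSpace n} (hz : z ∈ unitBall n) (v : CSpace n) :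
    bergmanMetric (unitBall n) z v =
      (n + 1) * (‖v‖ ^ 2 / (1 - ‖z‖ ^ 2) + ‖⟪z, v⟫_ℂ‖ ^ 2 / (1 - ‖z‖ ^ 2) ^ 2) := by
  rw [bergmanMetric, ← leviForm_log_kernel (inv_pos.2 volume_real_unitBall_pos) hz]
  refine Filter.EventuallyEq.leviForm_eq ?_ v
  filter_upwards [isOpen_ball.mem_nhds hz] with w hw
  rw [bergmanKernel_unitBall_self hw, Complex.ofReal_re, ballKernel]

end

/-! ### Marty's criterion and the main theorem -/

section

variable {n : ℕ}

theorem closedBall_half_subset_unitBall : closedBall (0 : CSpace n) (1 / 2) ⊆ unitBall n :=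
  closedBall_subset_ball (by norm_num)

/-- A bound on a function, or on its reciprocal, bounds its spherical derivative. -/
theorem norm_fderiv_zero_le_of_norm_le {f : CSpace n → ℂ}
    (hf : DifferentiableOn ℂ f (unitBall n)) {M : ℝ}
    (hM : ∀ z ∈ closedBall (0 : CSpace n) (1 / 2), ‖f z‖ ≤ M) :
    ‖fderiv ℂ f 0‖ ≤ 4 * M * (1 + ‖f 0‖ ^ 2) := by
  have hM0 : 0 ≤ M := (norm_nonneg _).trans (hM 0 (by simp))
  have h := norm_fderiv_le_of_norm_le_on_ball (c := (0 : CSpace n)) (R := 1 / 2) (by norm_num)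
    (hf.mono (ball_subset_closedBall.trans closedBall_half_subset_unitBall))
    fun z hz => hM z (ball_subset_closedBall hz)
  have h2 : 0 ≤ M * ‖f 0‖ ^ 2 := by positivity
  linarith

/-- Cauchy's estimate is applied to `1/f`, bounded by 1 on radius 1/2, and `‖d(1/f)‖ = ‖df‖ / |f|²`.
-/
theorem norm_fderiv_zero_le_of_one_lt_norm {f : CSpace n → ℂ}
    (hf : DifferentiableOn ℂ f (unitBall n))
    (h1 : ∀ z ∈ closedBall (0 : CSpace n) (1 / 2), 1 < ‖f z‖) :
    ‖fderiv ℂ f 0‖ ≤ 4 * (1 + ‖f 0‖ ^ 2) := by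
  have hne : ∀ z ∈ closedBall (0 : CSpace n) (1 / 2), f z ≠ 0 := fun z hz h0 => by
    have := h1 z hz
    rw [h0, norm_zero] at this
    linarith
  have hsub : ball (0 : CSpace n) (1 / 2) ⊆ closedBall 0 (1 / 2) := ball_subset_closedBall
  have h0 : (0 : CSpace n) ∈ closedBall 0 (1 / 2) := by simp
  have hd : DifferentiableOn ℂ (fun z => (f z)⁻¹) (ball (0 : CSpace n) (1 / 2)) :=
    (hf.mono (hsub.trans closedBall_half_subset_unitBall)).fun_inv fun z hz => hne z (hsub hz)
  have h := norm_fderiv_le_of_norm_le_on_ball (M := 1) (by norm_num) hd fun z hz => by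
    rw [norm_inv]
    exact inv_le_one_of_one_le₀ (h1 z (hsub hz)).le
  have hf0 := (hf.differentiableAt (isOpen_ball.mem_nhds zero_mem_unitBall)).hasFDerivAt
  have hinv := ((hasDerivAt_inv (hne 0 h0)).comp_hasFDerivAt 0 hf0).fderiv
  have heq : ‖fderiv ℂ (fun z => (f z)⁻¹) 0‖ = (‖f 0‖ ^ 2)⁻¹ * ‖fderiv ℂ f 0‖ := by
    have h2 : fderiv ℂ (fun z => (f z)⁻¹) 0 = -(f 0 ^ 2)⁻¹ • fderiv ℂ f 0 := hinv
    rw [h2, norm_smul, norm_neg, norm_inv, norm_pow]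
  have hpos : 0 < ‖f 0‖ ^ 2 := by
    have := h1 0 h0
    positivity
  rw [heq, inv_mul_eq_div, div_le_iff₀ hpos] at h
  norm_num at h
  linarith

/-- A normal family of holomorphic functions on the ball has bounded spherical derivatives
at the centre. -/
theorem IsNormalFamily.exists_norm_fderiv_zero_le {F : Set (CSpace n → ℂ)}
    (hol : ∀ f ∈ F, DifferentiableOn ℂ f (unitBall n)) (hF : IsNormalFamily (unitBall n) F) :
    ∃ C : ℝ, ∀ f ∈ F, ‖fderiv ℂ f 0‖ ≤ C * (1 + ‖f 0‖ ^ 2) := by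
  by_contra! hcon
  -- The member `f j` violates the bound with constant `j`.
  choose f hfF hf using fun j : ℕ => hcon j
  have hK : IsCompact (closedBall (0 : CSpace n) (1 / 2)) := isCompact_closedBall _ _
  obtain ⟨s, hs, hconv⟩ := hF f hfF
  obtain ⟨C, hC⟩ : ∃ C : ℝ, ∀ᶠ j in atTop,
      ‖fderiv ℂ (f (s j)) 0‖ ≤ C * (1 + ‖f (s j) 0‖ ^ 2) := by
    rcases hconv with ⟨f₀, hf₀⟩ | hinf
    · have hu := hf₀ _ closedBall_half_subset_unitBall hK
      -- Late terms stay within 1 of the fixed term `f (s N)`, which is bounded on the compact ball;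
      -- nothing about `f₀` is used.
      obtain ⟨N, hN⟩ := Metric.uniformCauchySeqOn_iff.1 hu.uniformCauchySeqOn 1 one_pos
      obtain ⟨M, hM⟩ := hK.exists_bound_of_continuousOn
        ((hol _ (hfF (s N))).continuousOn.mono closedBall_half_subset_unitBall)
      refine ⟨4 * (M + 1), eventually_atTop.2 ⟨N, fun j hj => ?_⟩⟩
      refine norm_fderiv_zero_le_of_norm_le (hol _ (hfF _)) fun z hz => ?_
      have h1 := hN j hj N le_rfl z hz
      rw [dist_eq_norm] at h1
      have h2 := norm_sub_norm_le (f (s j) z) (f (s N) z)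
      linarith [hM z hz]
    · exact ⟨4, (hinf _ closedBall_half_subset_unitBall hK 1).mono fun j hj =>
        norm_fderiv_zero_le_of_one_lt_norm (hol _ (hfF _)) hj⟩
  obtain ⟨j, hj, hjC⟩ := (hC.and (hs.tendsto_atTop.eventually
    (eventually_ge_atTop ⌈C⌉₊))).exists
  have h1 := hf (s j)
  have h2 : C ≤ s j := Nat.ceil_le.1 hjC
  have h3 : 0 < 1 + ‖f (s j) 0‖ ^ 2 := by positivity
  nlinarith

end

end

theorem mainTheorem4 (n : ℕ) (F : Set (CSpace n → ℂ))
    (hol : ∀ f ∈ F, DifferentiableOn ℂ f (unitBall n))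
    (hinv : IsAutInvariant (unitBall n) F)
    (hnormal : IsNormalFamily (unitBall n) F) :
    ∃ C : ℝ, ∀ f ∈ F, ∀ z ∈ unitBall n, ∀ v : CSpace n,
      leviForm (fun w => Real.log (1 + ‖f w‖ ^ 2)) z v ≤
        C * bergmanMetric (unitBall n) z v := by
  obtain ⟨C, hC⟩ := hnormal.exists_norm_fderiv_zero_le hol
  refine ⟨C ^ 2 / (n + 1), fun f hf a ha v => ?_⟩
  obtain ⟨h, hhF, hh⟩ := hinv f hf _ (isAutomorphism_ballInvolution ha)
  -- Invariance gives equality only on the ball, which suffices for the derivatives at `0`.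
  have hev : h =ᶠ[nhds 0] f ∘ ballInvolution a :=
    Filter.mem_of_superset (Metric.isOpen_ball.mem_nhds zero_mem_unitBall) hh
  have hfa : HasFDerivAt f (fderiv ℂ f a) (ballInvolution a 0) := by
    rw [ballInvolution_zero]
    exact ((hol f hf).differentiableAt (Metric.isOpen_ball.mem_nhds ha)).hasFDerivAt
  have hderiv : fderiv ℂ h 0 = (fderiv ℂ f a).comp (ballInvolutionDeriv a 0) := by
    rw [hev.fderiv_eq]
    exact (hfa.comp 0 (hasFDerivAt_ballInvolution ha zero_mem_unitBall)).fderiv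
  have h0 : h 0 = f a := by simpa using hh zero_mem_unitBall
  have hbound := hC h hhF
  rw [h0] at hbound
  have hv : fderiv ℂ f a v = fderiv ℂ h 0 (ballInvolutionDeriv a a v) := by
    rw [hderiv, ContinuousLinearMap.comp_apply, ballInvolutionDeriv_zero_comp_self ha]
  have hle : ‖fderiv ℂ f a v‖ ≤ C * (1 + ‖f a‖ ^ 2) * ‖ballInvolutionDeriv a a v‖ := by
    rw [hv]
    exact (ContinuousLinearMap.le_opNorm _ _).trans
      (mul_le_mul_of_nonneg_right hbound (norm_nonneg _))
  have hsq := pow_le_pow_left₀ (norm_nonneg _) hle 2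
  rw [mul_pow, mul_pow, norm_sq_ballInvolutionDeriv_self ha] at hsq
  rw [leviForm_log_one_add_norm_sq Metric.isOpen_ball (hol f hf) ha, bergmanMetric_unitBall ha,
    div_le_iff₀ (by positivity)]
  refine hsq.trans_eq ?_
  have hn : (n + 1 : ℝ) ≠ 0 := by positivity
  field_simp
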